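/- Let $D>0$ (the normalized power of the constant power load, unknown to the controller) and $x_{2\star}>0$ (the desired normalized output voltage), and put $x_{1\star}=\frac{D}{x_{2\star}}+D$, $x_\star=(x_{1\star},x_{2\star})$. Consider, on the state space $x_1,x_2>0$, the normalized average model of the DC-DC buck-boost converter with constant power load $$\dot x_1=-(1-u)x_2+u,\qquad \dot x_2=(1-u)x_1-\frac{D}{x_2},$$ in closed loop with the adaptive controller $u=\bar u(x,\hat D,k_1)$ and the immersion-and-invariance estimator $$\hat D=-\tfrac12\gamma x_2^2+D_I,\qquad \dot D_I=\gamma x_1x_2(1-u)+\tfrac12\gamma^2x_2^2-\gamma D_I ,$$ where $k_1$ is a gain and $\gamma>0$ is a free gain. Here, with $q=2x_1^2+x_2^2$ and $A=\arctan\frac{x_1}{\sqrt{x_1^2+x_2^2/2}}$, $$\begin{aligned}\bar u(x,D,k_1)=\frac{1}{x_1^2+(x_2+1)^2}\Big(&x_2(x_2+1)+x_1\big(x_1-\tfrac{D}{x_2}\big)\\&-\Big(\frac{x_2(x_2+1)}{x_1}+\frac{2x_1x_2}{x_2+1}\Big)\Big(k_1x_1\big(2(k_2+x_1^2)+x_2^2\big)-\frac{D(1+x_2)}{q}+\frac{\sqrt2Dx_1A}{q^{3/2}}\Big)\\&+\frac{1}{2x_2q^{3/2}}\Big(\frac{2x_1^2}{(x_2+1)^2}-2x_2\Big)\Big(\sqrt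 q\,\big(2Dx_1(1+x_2)+x_2q(-1+2k_1x_2(k_2+x_1^2)+k_1x_2^3)\big)+\sqrt2Dx_2^2A\Big)\Big),\end{aligned}$$ $$k_2=\frac1{k_1}\left[\frac{D(1+x_{2\star})}{2x_{1\star}q_\star}-\frac{\sqrt2\,D\,x_{1\star}A_\star}{2x_{1\star}q_\star^{3/2}}\right]-\frac{x_{2\star}^2}{2}-x_{1\star}^2 ,$$ where $q_\star,A_\star$ are $q,A$ at $x=x_\star$. In $k_2$, too, $x_{1\star}$ is understood as the function $\frac{D}{x_{2\star}}+D$ of $D$, so that in $\bar u(x,\hat D,k_1)$ every $D$ is replaced by $\hat D$; at $\hat D=0$ the removable singularity of $k_2$ is removed. Then the following holds. (i) For all initial conditions of the closed loop and all $D_I(0)$, the estimation error $\tilde D:=\hat D-D$ satisfies $\tilde D(t)=e^{-\gamma t}\tilde D(0)$ for as long as the solution exists. (ii) If $x_{2\star}^2(1+x_{2\star})>2x_{1\star}^2$, then there is $k_1^{\min}$ (depending only on $D$ and $x_{2\star}$) such that for all $k_1>k_1^{\min}$ and all $\gamma>0$, $(x,\hat D)=(x_\star,D)$ is a locally asymptotically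 stable equilibrium of the overall closed loop. -/

import Mathlib

open Set Filter Topology

namespace BuckBoost

noncomputable section

/-! Asymptotic stability of an equilibrium of a time-invariant system, the system being given by its
trajectories: `traj I s` says that the curve `s` is a trajectory on the time interval `I`. -/

/-- Local (Lyapunov) asymptotic stability of the point `p`:
the constant curve `p` is a trajectory; trajectories starting near `p` exist for all `t ≥ 0`;
`p` is Lyapunov stable (also along trajectories that are only given on a finite interval `[0, T)`);
and `p` is locally attractive. -/
structure IsAsymptoticallyStable {E : Type*} [MetricSpace E]
    (traj : Set ℝ → (ℝ → E) → Prop) (p : E) : Prop where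
  equilibrium : traj (Ici 0) (fun _ => p)
  global_existence : ∃ δ > 0, ∀ s₀ : E, dist s₀ p < δ → ∃ s : ℝ → E, s 0 = s₀ ∧ traj (Ici 0) s
  stable : ∀ ε > 0, ∃ δ > 0, ∀ T > 0, ∀ s : ℝ → E, traj (Ico 0 T) s → dist (s 0) p < δ →
    ∀ t ∈ Ico 0 T, dist (s t) p < ε
  attractive : ∃ δ > 0, ∀ s : ℝ → E, traj (Ici 0) s → dist (s 0) p < δ → Tendsto s atTop (𝓝 p)

/-! The controller. -/

/-- `x₁⋆ = D / x₂⋆ + D`, the first coordinate of the assignable equilibrium with second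
coordinate `x₂⋆ = x2s`. -/
def x1Star (D x2s : ℝ) : ℝ := D / x2s + D

/-- The expression `arctan (x₁ / √(x₁² + x₂²/2))` of the controller. -/
def arctanTerm (x1 x2 : ℝ) : ℝ := Real.arctan (x1 / √(x1 ^ 2 + x2 ^ 2 / 2))

/-- The constant `k₂` of the controller. Here the common factor `D / x₁⋆ = x₂⋆ / (1 + x₂⋆)` has been
cancelled, so that the expression is also meaningful where the power estimate, which is put in the
place of `D`, passes through `0`; see `k2_eq` for the uncancelled expression. -/
def k2 (D k1 x2s : ℝ) : ℝ :=
  1 / k1 *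
    (x2s / (2 * (2 * x1Star D x2s ^ 2 + x2s ^ 2))
      - √2 * D * arctanTerm (x1Star D x2s) x2s
        / (2 * (2 * x1Star D x2s ^ 2 + x2s ^ 2) ^ (3 / 2 : ℝ)))
    - x2s ^ 2 / 2 - x1Star D x2s ^ 2

theorem k2_eq (D k1 x2s : ℝ) (hD : D ≠ 0) (hx : 0 < x2s) :
    k2 D k1 x2s =
      1 / k1 *
        (D * (1 + x2s) / (2 * x1Star D x2s * (2 * x1Star D x2s ^ 2 + x2s ^ 2))
          - √2 * D * x1Star D x2s * arctanTerm (x1Star D x2s) x2s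
            / (2 * x1Star D x2s * (2 * x1Star D x2s ^ 2 + x2s ^ 2) ^ (3 / 2 : ℝ)))
        - x2s ^ 2 / 2 - x1Star D x2s ^ 2 := by
  have h1 : x1Star D x2s ≠ 0 := by
    have h : x1Star D x2s = D * (1 + x2s) / x2s := by
      unfold x1Star; field_simp
    rw [h]; positivity
  have hD2 : D * (1 + x2s) = x1Star D x2s * x2s := by
    unfold x1Star; field_simp
  have hq : 0 < 2 * x1Star D x2s ^ 2 + x2s ^ 2 := by positivity
  have hr : 0 < (2 * x1Star D x2s ^ 2 + x2s ^ 2) ^ (3 / 2 : ℝ) := Real.rpow_pos_of_pos hq _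
  rw [k2, hD2]
  congr 3
  congr 1
  · field_simp
  · field_simp

/-- The feedback `ū(x, D, k₁)`, for the desired output voltage `x₂⋆ = x2s`. -/
def uBar (x2s x1 x2 D k1 : ℝ) : ℝ :=
  1 / (x1 ^ 2 + (x2 + 1) ^ 2) *
    (x2 * (x2 + 1) + x1 * (x1 - D / x2)
      - (x2 * (x2 + 1) / x1 + 2 * x1 * x2 / (x2 + 1)) *
        (k1 * x1 * (2 * (k2 D k1 x2s + x1 ^ 2) + x2 ^ 2)
          - D * (1 + x2) / (2 * x1 ^ 2 + x2 ^ 2)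
          + √2 * D * x1 * arctanTerm x1 x2 / (2 * x1 ^ 2 + x2 ^ 2) ^ (3 / 2 : ℝ))
      + 1 / (2 * x2 * (2 * x1 ^ 2 + x2 ^ 2) ^ (3 / 2 : ℝ)) *
        (2 * x1 ^ 2 / (x2 + 1) ^ 2 - 2 * x2) *
        (√(2 * x1 ^ 2 + x2 ^ 2) *
            (2 * D * x1 * (1 + x2)
              + x2 * (2 * x1 ^ 2 + x2 ^ 2) *
                (-1 + 2 * k1 * x2 * (k2 D k1 x2s + x1 ^ 2) + k1 * x2 ^ 3))
          + √2 * D * x2 ^ 2 * arctanTerm x1 x2))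

/-! The closed loop. -/

/-- The curve `s = (x₁, x₂, D̂)` is, on the time interval `I`, a trajectory of the normalized
buck-boost converter with constant power load `D`, evolving in `x₁, x₂ > 0`, in closed loop with
`u = ū(x, D̂, k₁)` and the estimator `D̂ = -γ x₂² / 2 + D_I` with estimator state `D_I`. -/
def IsClosedLoopTrajectory (D x2s k1 γ : ℝ) (I : Set ℝ) (s : ℝ → ℝ × ℝ × ℝ) : Prop :=
  ∃ x1 x2 Dhat DI u : ℝ → ℝ,
    (∀ t, s t = (x1 t, x2 t, Dhat t)) ∧
    ∀ t ∈ I,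
      0 < x1 t ∧ 0 < x2 t ∧
      u t = uBar x2s (x1 t) (x2 t) (Dhat t) k1 ∧
      HasDerivWithinAt x1 (-(1 - u t) * x2 t + u t) I t ∧
      HasDerivWithinAt x2 ((1 - u t) * x1 t - D / x2 t) I t ∧
      Dhat t = -(1 / 2) * γ * x2 t ^ 2 + DI t ∧
      HasDerivWithinAt DI
        (γ * x1 t * x2 t * (1 - u t) + 1 / 2 * γ ^ 2 * x2 t ^ 2 - γ * DI t) I t

end

end BuckBoost

/-!
The estimator is built so that the estimation error satisfies `(D̂ - D)' = -γ (D̂ - D)`, whatever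
the voltage and the current do. This gives the exponential formula, and it makes the linearization
of the closed loop block triangular, with the eigenvalue `-γ` and a planar block that is the
linearization of the converter under full information.

Stability is read off from that linearization. The feedback has the form `u = |g|⁻² gᵀ(F_d (a, b)
- f)` for a converter `x' = f + u g` and a matrix `F_d` that depends only on `x`, where `a` (here
`potentialSlope`) and `b` are tied by the matching condition `x₂ a - 2 x₁ b = x₁ - D̂ (x₂ + 1) /
x₂`. Hence the closed loop is `F_d (a, b)` up to a term in `D̂ - D`, and eliminating `b` leaves a
field that is affine in `a`. Since `a` vanishes at the equilibrium, only its differential enters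
the linearization. That differential is `k₁ (4 x₁⋆², 2 x₁⋆ x₂⋆)` plus a covector independent of
`k₁`, which need not be computed (so neither the arctangent nor the fractional powers are ever
differentiated explicitly). The planar block is thus a rank-one perturbation of a fixed matrix,
with trace and determinant affine in `k₁`. The coefficient of `k₁` in the trace is always
negative; in the determinant it is a positive multiple of `x₂⋆² (1 + x₂⋆) - 2 x₁⋆²`. So for large
`k₁` the linearization is stable (`exists_gain_trace_neg_det_pos`).

The passage from the linearization to the nonlinear system is Lyapunov's indirect method with an
explicit quadratic Lyapunov function (`exists_quadratic_lyapunov_cascade`,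
`isAsymptoticallyStable_of_quadratic`). It includes global existence near the equilibrium: a
cut-off field is bounded and Lipschitz, so it has global solutions, and these never leave the
region where the cut-off field is the given one.
-/

namespace BuckBoost

open Metric
open scoped NNReal ContDiff

/-! ### Global solutions of ordinary differential equations -/

/-- A bounded, globally Lipschitz autonomous vector field has a solution on all of `ℝ` through
every point. Boundedness lets Picard–Lindelöf be applied on arbitrarily long time intervals, on a
ball whose radius grows with the interval; the solutions are glued by uniqueness. -/
theorem exists_global_solution {E : Type*} [NormedAddCommGroup E] [NormedSpace ℝ E]
    [CompleteSpace E] {f : E → E} {K C : ℝ≥0} (hf : LipschitzWith K f) (hb : ∀ x, ‖f x‖ ≤ C)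
    (x : E) : ∃ α : ℝ → E, α 0 = x ∧ ∀ t, HasDerivAt α (f (α t)) t := by
  have hloc : ∀ n : ℕ, ∃ α : ℝ → E, α 0 = x ∧
      ∀ t ∈ Ioo (-(n + 1) : ℝ) (n + 1), HasDerivAt α (f (α t)) t := by
    intro n
    have hn : (0 : ℝ) < n + 1 := by positivity
    have hpl : IsPicardLindelof (fun _ => f)
        (⟨0, by constructor <;> linarith⟩ : Icc (-(n + 1) : ℝ) (n + 1)) x (C * (n + 1)) 0 C K :=
      IsPicardLindelof.of_time_independent (fun y _ => hb y) hf.lipschitzOnWith (by simp)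
    obtain ⟨α, h0, hα⟩ := hpl.exists_eq_forall_mem_Icc_hasDerivWithinAt₀
    exact ⟨α, h0, fun t ht =>
      (hα t (Ioo_subset_Icc_self ht)).hasDerivAt (Icc_mem_nhds ht.1 ht.2)⟩
  choose α hα0 hα using hloc
  have heq : ∀ m n : ℕ, m ≤ n → EqOn (α m) (α n) (Ioo (-(m + 1) : ℝ) (m + 1)) := by
    intro m n hmn
    have hmn' : (m : ℝ) ≤ n := by exact_mod_cast hmn
    have hm : (0 : ℝ) < m + 1 := by positivity
    refine ODE_solution_unique_of_mem_Ioo (v := fun _ => f) (s := fun _ => univ) (K := K) (t₀ := 0)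
      (fun t _ => hf.lipschitzOnWith) ⟨by linarith, hm⟩ (fun t ht => ⟨hα m t ht, mem_univ _⟩)
      (fun t ht => ⟨hα n t ⟨?_, ?_⟩, mem_univ _⟩) ((hα0 m).trans (hα0 n).symm)
    · linarith [ht.1]
    · linarith [ht.2]
  refine ⟨fun t => α ⌈|t|⌉₊ t, by simp [hα0], fun t => ?_⟩
  set N := ⌈|t|⌉₊ with hN
  have htN : t ∈ Ioo (-(N + 1) : ℝ) (N + 1) := by
    have h := Nat.le_ceil |t|
    have h' := abs_le.1 (h.trans (le_refl (N : ℝ)))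
    exact ⟨by linarith [h'.1], by linarith [h'.2]⟩
  have hev : (fun t => α ⌈|t|⌉₊ t) =ᶠ[𝓝 t] α (N + 1) := by
    filter_upwards [Ioo_mem_nhds htN.1 htN.2] with τ hτ
    have hτ' : |τ| ≤ ((N + 1 : ℕ) : ℝ) := by
      push_cast; exact (abs_lt.2 hτ).le
    refine heq _ _ (Nat.ceil_le.2 hτ') ?_
    have h' := abs_le.1 (Nat.le_ceil |τ|)
    exact ⟨by linarith [h'.1], by linarith [h'.2]⟩
  have hd := (hα (N + 1) t ⟨by push_cast; linarith [htN.1], by push_cast; linarith [htN.2]⟩)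
  rw [show f (α N t) = f (α (N + 1) t) by rw [heq N (N + 1) (Nat.le_succ N) htN]]
  exact hd.congr_of_eventuallyEq hev

/-- A vector field that is `C¹` at `p` agrees near `p` with a bounded, globally Lipschitz one. -/
theorem exists_lipschitz_cutoff {E : Type*} [NormedAddCommGroup E] [NormedSpace ℝ E]
    [FiniteDimensional ℝ E] {F : E → E} {p : E} (hF : ContDiffAt ℝ 1 F p) :
    ∃ G : E → E, (∃ K : ℝ≥0, LipschitzWith K G) ∧ (∃ C : ℝ≥0, ∀ x, ‖G x‖ ≤ C) ∧ G =ᶠ[𝓝 p] F := by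
  obtain ⟨ε, hε, hball⟩ : ∃ ε > 0, ∀ z ∈ ball p ε, ContDiffAt ℝ 1 F z := by
    obtain ⟨ε, hε, h⟩ := Metric.eventually_nhds_iff_ball.1 (hF.eventually (by simp))
    exact ⟨ε, hε, h⟩
  let φ : ContDiffBump p := ⟨ε / 4, ε / 2, by positivity, by linarith⟩
  have hcomp : HasCompactSupport (fun z => φ z • F z) := φ.hasCompactSupport.smul_right
  have hsm : ContDiff ℝ 1 (fun z => φ z • F z) := by
    refine contDiff_iff_contDiffAt.2 fun z => ?_
    by_cases hz : z ∈ ball p ε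
    · exact φ.contDiffAt.smul (hball z hz)
    · have hz' : z ∉ tsupport φ := by
        rw [φ.tsupport_eq]
        intro h
        have h1 : dist z p ≤ ε / 2 := h
        exact hz (mem_ball.2 (by linarith))
      have hev : (fun z => φ z • F z) =ᶠ[𝓝 z] fun _ => 0 := by
        filter_upwards [notMem_tsupport_iff_eventuallyEq.1 hz'] with w hw
        simp [hw]
      exact contDiffAt_const.congr_of_eventuallyEq hev
  refine ⟨fun z => φ z • F z, hsm.lipschitzWith_of_hasCompactSupport hcomp (by simp), ?_, ?_⟩
  · obtain ⟨C, hC⟩ := hcomp.exists_bound_of_continuous hsm.continuous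
    exact ⟨⟨max C 0, le_max_right _ _⟩, fun x => (hC x).trans (le_max_left _ _)⟩
  · filter_upwards [φ.eventuallyEq_one] with z hz
    simp [hz]

/-! ### Quadratic Lyapunov functions -/

section Lyapunov

variable {E : Type*} [NormedAddCommGroup E] [NormedSpace ℝ E] {F : E → E} {p : E}
  {B : E →L[ℝ] E →L[ℝ] ℝ} {c : ℝ}

/-- Fencing for a quadratic Lyapunov function `V z = B (z - p) (z - p)`: if `V` decreases at the
rate `2 β` on the ball of radius `r` about `p`, which contains the sublevel set `{V ≤ v}`, then `V`
decays like `exp (-β t)` along trajectories that start in that set. The rate `β` in place of `2 β`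
makes the comparison on the fence `V = v exp (-β t)` strict. -/
theorem lyapunov_decay (hsymm : ∀ z w, B z w = B w z) (hc : 0 < c)
    (hpos : ∀ z, c * ‖z‖ ^ 2 ≤ B z z) {r β v T : ℝ} (hr : 0 < r) (hβ : 0 < β) (hv : 0 < v)
    (hvr : v < c * r ^ 2)
    (hdec : ∀ z, ‖z - p‖ < r → B (z - p) (F z) ≤ -β * B (z - p) (z - p))
    {s : ℝ → E} (hs : ∀ t ∈ Ico 0 T, HasDerivWithinAt s (F (s t)) (Ico 0 T) t)
    (h0 : B (s 0 - p) (s 0 - p) ≤ v) :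
    ∀ t ∈ Ico 0 T, B (s t - p) (s t - p) ≤ v * Real.exp (-β * t) := by
  intro t ht
  have hd : ∀ τ ∈ Ico 0 T, HasDerivWithinAt (fun t => B (s t - p) (s t - p))
      (2 * B (s τ - p) (F (s τ))) (Ico 0 T) τ := by
    intro τ hτ
    have h1 := (hs τ hτ).sub_const p
    have h2 := (B.hasFDerivAt.comp_hasDerivWithinAt τ h1).clm_apply h1
    refine h2.congr_deriv ?_
    simp only [Function.comp_apply]
    rw [hsymm (F (s τ))]; ring
  have hsub : Icc 0 t ⊆ Ico 0 T := fun τ hτ => ⟨hτ.1, hτ.2.trans_lt ht.2⟩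
  have hB : ∀ τ, HasDerivAt (fun t => v * Real.exp (-β * t)) (v * (Real.exp (-β * τ) * (-β))) τ := by
    intro τ
    have h1 : HasDerivAt (fun t => -β * t) (-β) τ := by
      simpa using (hasDerivAt_id τ).const_mul (-β)
    exact h1.exp.const_mul v
  refine image_le_of_deriv_right_lt_deriv_boundary (a := 0) (b := t)
    (f := fun t => B (s t - p) (s t - p)) (f' := fun τ => 2 * B (s τ - p) (F (s τ)))
    (fun τ hτ => ((hd τ (hsub hτ)).continuousWithinAt).mono hsub) ?_ (by simpa using h0) hB ?_
    ⟨ht.1, le_rfl⟩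
  · intro τ hτ
    refine (hd τ (hsub ⟨hτ.1, hτ.2.le⟩)).mono_of_mem_nhdsWithin ?_
    exact mem_of_superset (Ico_mem_nhdsGE (hτ.2.trans ht.2))
      (Ico_subset_Ico_left hτ.1)
  · intro τ hτ heq
    have hexp : 0 < Real.exp (-β * τ) := Real.exp_pos _
    have hexp1 : Real.exp (-β * τ) ≤ 1 := Real.exp_le_one_iff.2 (by nlinarith [hτ.1])
    have hlt : c * ‖s τ - p‖ ^ 2 < c * r ^ 2 := by
      calc c * ‖s τ - p‖ ^ 2 ≤ v * Real.exp (-β * τ) := heq ▸ hpos _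
        _ ≤ v := mul_le_of_le_one_right hv.le hexp1
        _ < c * r ^ 2 := hvr
    have hnorm : ‖s τ - p‖ < r := lt_of_pow_lt_pow_left₀ 2 hr.le (lt_of_mul_lt_mul_left hlt hc.le)
    have h := hdec _ hnorm
    rw [heq] at h
    have : 0 < β * (v * Real.exp (-β * τ)) := by positivity
    linarith

/-- If `B z (L z)` is negative definite for the linearization `L` of `F` at the zero `p`, then
`B (z - p) (F z)` is negative definite near `p`. -/
theorem exists_ball_lyapunov_decrease {L : E →L[ℝ] E} {m : ℝ} (hp : F p = 0)
    (hL : HasFDerivAt F L p) (hm : 0 < m) (hneg : ∀ z, B z (L z) ≤ -m * ‖z‖ ^ 2) :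
    ∃ β > 0, ∀ᶠ z in 𝓝 p, B (z - p) (F z) ≤ -β * B (z - p) (z - p) := by
  refine ⟨m / (2 * (‖B‖ + 1)), by positivity, ?_⟩
  have hsmall := hL.isLittleO.bound (c := m / (2 * (‖B‖ + 1))) (by positivity)
  filter_upwards [hsmall] with z hz
  rw [hp, sub_zero] at hz
  have hB0 : 0 ≤ ‖B‖ := by positivity
  have h1 : B (z - p) (F z) = B (z - p) (L (z - p)) + B (z - p) (F z - L (z - p)) := by
    rw [← map_add, add_sub_cancel]
  have h2 : B (z - p) (F z - L (z - p)) ≤ ‖B‖ * ‖z - p‖ * (m / (2 * (‖B‖ + 1)) * ‖z - p‖) :=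
    (le_abs_self _).trans ((B.le_opNorm₂ _ _).trans (by gcongr))
  have h3 : B (z - p) (z - p) ≤ ‖B‖ * ‖z - p‖ * ‖z - p‖ :=
    (le_abs_self _).trans (B.le_opNorm₂ _ _)
  have h4 : m / (2 * (‖B‖ + 1)) * B (z - p) (z - p)
      ≤ m / (2 * (‖B‖ + 1)) * (‖B‖ * ‖z - p‖ * ‖z - p‖) := by gcongr
  have h5 : m / (2 * (‖B‖ + 1)) * ‖B‖ ≤ m / 2 := by
    rw [div_mul_eq_mul_div, div_le_div_iff₀ (by positivity) (by positivity)]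
    nlinarith
  have h6 : m / (2 * (‖B‖ + 1)) * ‖B‖ * ‖z - p‖ ^ 2 ≤ m / 2 * ‖z - p‖ ^ 2 := by gcongr
  have h7 := hneg (z - p)
  rw [h1]
  nlinarith

/-- **Lyapunov's indirect method** in finite dimension: a zero `p` of a vector field `F` that is
`C¹` at `p` is locally asymptotically stable if the linearization `L` admits a strict quadratic
Lyapunov function `B`. Trajectories are confined to a neighbourhood `U` of `p`. -/
theorem isAsymptoticallyStable_of_quadratic [FiniteDimensional ℝ E] {U : Set E} (hU : U ∈ 𝓝 p)
    (hF : ContDiffAt ℝ 1 F p) (hp : F p = 0) {L : E →L[ℝ] E} (hL : HasFDerivAt F L p)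
    (hsymm : ∀ z w, B z w = B w z) {m : ℝ} (hc : 0 < c) (hm : 0 < m)
    (hpos : ∀ z, c * ‖z‖ ^ 2 ≤ B z z) (hneg : ∀ z, B z (L z) ≤ -m * ‖z‖ ^ 2) :
    IsAsymptoticallyStable
      (fun I s => ∀ t ∈ I, s t ∈ U ∧ HasDerivWithinAt s (F (s t)) I t) p := by
  obtain ⟨β, hβ, hdec⟩ := exists_ball_lyapunov_decrease hp hL hm hneg
  have hnear : ∀ v > 0, ∃ δ > 0, ∀ z, dist z p < δ → B (z - p) (z - p) ≤ v := by
    intro v hv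
    have hcont : Continuous fun z => B (z - p) (z - p) := by fun_prop
    have h0 : ∀ᶠ z in 𝓝 p, B (z - p) (z - p) < v :=
      hcont.continuousAt.eventually_lt continuousAt_const (by simpa using hv)
    obtain ⟨δ, hδ, h⟩ := Metric.eventually_nhds_iff.1 h0
    exact ⟨δ, hδ, fun z hz => (h hz).le⟩
  have hfar : ∀ r > 0, ∀ z, B (z - p) (z - p) < c * r ^ 2 → dist z p < r := by
    intro r hr z hz
    rw [dist_eq_norm]
    exact lt_of_pow_lt_pow_left₀ 2 hr.le (lt_of_mul_lt_mul_left ((hpos _).trans_lt hz) hc.le)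
  obtain ⟨r₀, hr₀, hr₀dec⟩ := Metric.eventually_nhds_iff.1 hdec
  refine ⟨?_, ?_, ?_, ?_⟩
  · intro t _
    exact ⟨mem_of_mem_nhds hU, by simpa [hp] using hasDerivWithinAt_const t (Ici 0) p⟩
  · obtain ⟨G, ⟨K, hGK⟩, ⟨C, hGC⟩, hGF⟩ := exists_lipschitz_cutoff hF
    obtain ⟨r, hr, hrG⟩ := Metric.eventually_nhds_iff.1 (hGF.and (hdec.and hU))
    obtain ⟨δ, hδ, hδv⟩ := hnear (c * r ^ 2 / 2) (by positivity)
    refine ⟨δ, hδ, fun s₀ hs₀ => ?_⟩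
    obtain ⟨s, hs0, hs⟩ := exists_global_solution hGK hGC s₀
    refine ⟨s, hs0, fun t ht => ?_⟩
    have hlt : c * r ^ 2 / 2 < c * r ^ 2 := half_lt_self (by positivity)
    have hV := lyapunov_decay (F := G) (T := t + 1) hsymm hc hpos hr hβ (by positivity) hlt
      (fun z hz => by
        have h := hrG (y := z) (by rwa [dist_eq_norm])
        rw [h.1]; exact h.2.1)
      (fun τ _ => (hs τ).hasDerivWithinAt) (hδv _ (hs0 ▸ hs₀)) t ⟨ht, by linarith⟩
    have hexp1 : Real.exp (-β * t) ≤ 1 := Real.exp_le_one_iff.2 (by nlinarith [mem_Ici.1 ht])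
    have hball : dist (s t) p < r := hfar r hr _ (hV.trans_lt
      ((mul_le_of_le_one_right (by positivity) hexp1).trans_lt hlt))
    have h := hrG hball
    refine ⟨h.2.2, ?_⟩
    rw [← h.1]
    exact (hs t).hasDerivWithinAt
  · intro ε hε
    set r := min r₀ ε with hr
    have hr0 : 0 < r := lt_min hr₀ hε
    obtain ⟨δ, hδ, hδv⟩ := hnear (c * r ^ 2 / 2) (by positivity)
    refine ⟨δ, hδ, fun T hT s hs hs0 t ht => ?_⟩
    have hlt : c * r ^ 2 / 2 < c * r ^ 2 := half_lt_self (by positivity)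
    have hV := lyapunov_decay (F := F) (T := T) hsymm hc hpos hr0 hβ (by positivity) hlt
      (fun z hz => hr₀dec (by rw [dist_eq_norm]; exact hz.trans_le (min_le_left _ _)))
      (fun τ hτ => (hs τ hτ).2) (hδv _ hs0) t ht
    have hexp1 : Real.exp (-β * t) ≤ 1 := Real.exp_le_one_iff.2 (by nlinarith [ht.1])
    exact (hfar r hr0 _ (hV.trans_lt
      ((mul_le_of_le_one_right (by positivity) hexp1).trans_lt hlt))).trans_le (min_le_right _ _)
  · obtain ⟨δ, hδ, hδv⟩ := hnear (c * r₀ ^ 2 / 2) (by positivity)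
    refine ⟨δ, hδ, fun s hs hs0 => ?_⟩
    have hlt : c * r₀ ^ 2 / 2 < c * r₀ ^ 2 := half_lt_self (by positivity)
    have hV : ∀ t ≥ 0, B (s t - p) (s t - p) ≤ c * r₀ ^ 2 / 2 * Real.exp (-β * t) := fun t ht =>
      lyapunov_decay (F := F) (T := t + 1) hsymm hc hpos hr₀ hβ (by positivity) hlt
        (fun z hz => hr₀dec (by rwa [dist_eq_norm]))
        (fun τ hτ => ((hs τ hτ.1).2).mono fun σ hσ => hσ.1) (hδv _ hs0) t ⟨ht, by linarith⟩
    have hlim : Tendsto (fun t => c * r₀ ^ 2 / 2 * Real.exp (-β * t)) atTop (𝓝 0) := by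
      have h1 : Tendsto (fun t : ℝ => -β * t) atTop atBot :=
        tendsto_id.const_mul_atTop_of_neg (neg_lt_zero.2 hβ)
      simpa using (Real.tendsto_exp_atBot.comp h1).const_mul (c * r₀ ^ 2 / 2)
    refine Metric.tendsto_nhds.2 fun ε hε => ?_
    filter_upwards [eventually_ge_atTop 0, hlim.eventually_lt_const (u := c * ε ^ 2)
      (by positivity)] with t ht hlt'
    exact hfar ε hε _ ((hV t ht).trans_lt hlt')

end Lyapunov

/-! ### Quadratic Lyapunov functions for planar cascades -/

/-- The linear functional with coefficients `a`, `b`, `c` on `ℝ × ℝ × ℝ`. -/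
noncomputable def functional (a b c : ℝ) : ℝ × ℝ × ℝ →L[ℝ] ℝ :=
  a • ContinuousLinearMap.fst ℝ ℝ (ℝ × ℝ)
    + b • (ContinuousLinearMap.fst ℝ ℝ ℝ).comp (ContinuousLinearMap.snd ℝ ℝ (ℝ × ℝ))
    + c • (ContinuousLinearMap.snd ℝ ℝ ℝ).comp (ContinuousLinearMap.snd ℝ ℝ (ℝ × ℝ))

@[simp]
theorem functional_apply (a b c : ℝ) (z : ℝ × ℝ × ℝ) :
    functional a b c z = a * z.1 + b * z.2.1 + c * z.2.2 := by
  simp [functional]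

/-- A strict quadratic Lyapunov function for a cascade of a scalar system with eigenvalue `-γ` and
a planar system whose matrix `A` has negative trace and positive determinant. On the plane it is
`|adj A z|² + det A |z|²`, whose derivative along `A` is `2 det A tr A |z|²`; a large multiple
`κ` of the square of the third coordinate absorbs the coupling. -/
theorem exists_quadratic_lyapunov_cascade {a11 a12 a13 a21 a22 a23 γ : ℝ} (hγ : 0 < γ)
    (htr : a11 + a22 < 0) (hdet : 0 < a11 * a22 - a12 * a21) :
    ∃ B : ℝ × ℝ × ℝ →L[ℝ] ℝ × ℝ × ℝ →L[ℝ] ℝ, ∃ c > 0, ∃ m > 0,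
      (∀ z w, B z w = B w z) ∧ (∀ z, c * ‖z‖ ^ 2 ≤ B z z) ∧
      ∀ z, B z ((functional a11 a12 a13).prod
        ((functional a21 a22 a23).prod (functional 0 0 (-γ))) z) ≤ -m * ‖z‖ ^ 2 := by
  set Δ := a11 * a22 - a12 * a21 with hΔ
  set μ := -(Δ * (a11 + a22)) with hμ
  have hμ0 : 0 < μ := by
    rw [hμ]; nlinarith
  have hnorm : ∀ z : ℝ × ℝ × ℝ, ‖z‖ ^ 2 ≤ z.1 ^ 2 + z.2.1 ^ 2 + z.2.2 ^ 2 := by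
    intro z
    have h1 := sq_nonneg z.1
    have h2 := sq_nonneg z.2.1
    have h3 := sq_nonneg z.2.2
    rw [Prod.norm_def, Prod.norm_def]
    rcases max_choice ‖z.1‖ (max ‖z.2.1‖ ‖z.2.2‖) with h | h <;> rw [h]
    · rw [Real.norm_eq_abs, sq_abs]; linarith
    · rcases max_choice ‖z.2.1‖ ‖z.2.2‖ with h | h <;> rw [h, Real.norm_eq_abs, sq_abs] <;> linarith
  let f1 := functional a22 (-a12) 0
  let f2 := functional (-a21) a11 0
  -- `(σ z₁ + τ z₂) z₃` is the coupling term that the third column `(a13, a23)` produces.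
  set σ := a22 * (a22 * a13 - a12 * a23) - a21 * (a11 * a23 - a21 * a13) + Δ * a13 with hσ
  set τ := -a12 * (a22 * a13 - a12 * a23) + a11 * (a11 * a23 - a21 * a13) + Δ * a23 with hτ
  set κ := ((σ ^ 2 + τ ^ 2) / (2 * μ) + μ / 2) / γ with hκ
  have hκ0 : 0 < κ := by positivity
  have hκγ : κ * γ = (σ ^ 2 + τ ^ 2) / (2 * μ) + μ / 2 := by
    rw [hκ]; field_simp
  refine ⟨f1.smulRight f1 + f2.smulRight f2
    + Δ • ((functional 1 0 0).smulRight (functional 1 0 0)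
      + (functional 0 1 0).smulRight (functional 0 1 0))
    + κ • (functional 0 0 1).smulRight (functional 0 0 1), min Δ κ, lt_min hdet hκ0, μ / 2,
    by positivity, ?_, ?_, ?_⟩
  · intro z w
    simp [f1, f2]
    ring
  · intro z
    calc min Δ κ * ‖z‖ ^ 2 ≤ min Δ κ * (z.1 ^ 2 + z.2.1 ^ 2 + z.2.2 ^ 2) :=
          mul_le_mul_of_nonneg_left (hnorm z) (lt_min hdet hκ0).le
      _ = min Δ κ * (z.1 ^ 2 + z.2.1 ^ 2) + min Δ κ * z.2.2 ^ 2 := by ring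
      _ ≤ Δ * (z.1 ^ 2 + z.2.1 ^ 2) + κ * z.2.2 ^ 2 := by
          gcongr
          · exact min_le_left _ _
          · exact min_le_right _ _
      _ ≤ _ := by
          simp [f1, f2]
          nlinarith [sq_nonneg (a22 * z.1 + -(a12 * z.2.1)), sq_nonneg (-(a21 * z.1) + a11 * z.2.1)]
  · intro z
    have hB : ∀ x y e : ℝ, -μ * (x ^ 2 + y ^ 2) + (σ * x + τ * y) * e - κ * γ * e ^ 2
        ≤ -(μ / 2) * (x ^ 2 + y ^ 2 + e ^ 2) := by
      intro x y e
      rw [hκγ]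
      have h : 0 ≤ (μ * x - σ * e) ^ 2 / (2 * μ) + (μ * y - τ * e) ^ 2 / (2 * μ) := by positivity
      have h' : (μ * x - σ * e) ^ 2 / (2 * μ) + (μ * y - τ * e) ^ 2 / (2 * μ)
          = μ / 2 * (x ^ 2 + y ^ 2) - (σ * x + τ * y) * e
            + (σ ^ 2 + τ ^ 2) / (2 * μ) * e ^ 2 := by
        field_simp; ring
      linarith
    have h1 := hB z.1 z.2.1 z.2.2
    have h2 := mul_le_mul_of_nonneg_left (hnorm z) (half_pos hμ0).le
    refine le_trans (le_of_eq ?_) (h1.trans (by linarith))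
    simp [f1, f2]
    rw [hσ, hτ, hμ, hΔ]
    ring

/-! ### The closed-loop vector field -/

/-- The right-hand side of the closed loop in the coordinates `z = (x₁, x₂, D̂)`; the third
component is the dynamics of the estimate that the estimator induces. -/
noncomputable def closedLoopField (D x2s k1 γ : ℝ) (z : ℝ × ℝ × ℝ) : ℝ × ℝ × ℝ :=
  (-(1 - uBar x2s z.1 z.2.1 z.2.2 k1) * z.2.1 + uBar x2s z.1 z.2.1 z.2.2 k1,
    (1 - uBar x2s z.1 z.2.1 z.2.2 k1) * z.1 - D / z.2.1, -γ * (z.2.2 - D))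

/-- The estimator makes `D̂` obey `D̂' = -γ (D̂ - D)`. -/
theorem hasDerivWithinAt_estimate {D γ u : ℝ} {I : Set ℝ} {t : ℝ} {x1 x2 Dhat DI : ℝ → ℝ}
    (hx2 : 0 < x2 t) (ht : t ∈ I)
    (h2 : HasDerivWithinAt x2 ((1 - u) * x1 t - D / x2 t) I t)
    (hDhat : ∀ t ∈ I, Dhat t = -(1 / 2) * γ * x2 t ^ 2 + DI t)
    (hDI : HasDerivWithinAt DI
      (γ * x1 t * x2 t * (1 - u) + 1 / 2 * γ ^ 2 * x2 t ^ 2 - γ * DI t) I t) :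
    HasDerivWithinAt Dhat (-γ * (Dhat t - D)) I t := by
  have h := ((h2.pow 2).const_mul (-(1 / 2) * γ)).add hDI
  refine (h.congr hDhat (hDhat t ht)).congr_deriv ?_
  rw [hDhat t ht]
  field_simp
  ring

/-- Trajectories of the closed loop are the solution curves of `closedLoopField` in
`x₁, x₂ > 0`. -/
theorem isClosedLoopTrajectory_iff {D x2s k1 γ : ℝ} {I : Set ℝ} {s : ℝ → ℝ × ℝ × ℝ} :
    IsClosedLoopTrajectory D x2s k1 γ I s ↔ ∀ t ∈ I, s t ∈ {z : ℝ × ℝ × ℝ | 0 < z.1 ∧ 0 < z.2.1} ∧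
      HasDerivWithinAt s (closedLoopField D x2s k1 γ (s t)) I t := by
  constructor
  · rintro ⟨x1, x2, Dhat, DI, u, hs, h⟩ t ht
    obtain ⟨hx1, hx2, hu, h1, h2, -, hDI⟩ := h t ht
    have hs' : s = fun t => (x1 t, x2 t, Dhat t) := funext hs
    subst hs'
    have h3 := hasDerivWithinAt_estimate hx2 ht h2 (fun t ht => (h t ht).2.2.2.2.2.1) hDI
    rw [hu] at h1 h2
    exact ⟨⟨hx1, hx2⟩, h1.prodMk (h2.prodMk h3)⟩
  · intro h
    refine ⟨fun t => (s t).1, fun t => (s t).2.1, fun t => (s t).2.2,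
      fun t => (s t).2.2 + 1 / 2 * γ * (s t).2.1 ^ 2,
      fun t => uBar x2s (s t).1 (s t).2.1 (s t).2.2 k1, fun t => rfl, fun t ht => ?_⟩
    obtain ⟨⟨hx1, hx2⟩, hd⟩ := h t ht
    have h1 := hasFDerivAt_fst.comp_hasDerivWithinAt t hd
    have h23 := hasFDerivAt_snd.comp_hasDerivWithinAt t hd
    have h2 := hasFDerivAt_fst.comp_hasDerivWithinAt t h23
    have h3 := hasFDerivAt_snd.comp_hasDerivWithinAt t h23
    refine ⟨hx1, hx2, rfl, h1, h2, by ring, ?_⟩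
    refine (h3.add ((h2.pow 2).const_mul (1 / 2 * γ))).congr_deriv ?_
    simp only [closedLoopField, Function.comp_apply, ContinuousLinearMap.coe_fst',
      ContinuousLinearMap.coe_snd']
    field_simp
    ring

/-- The part of `potentialSlope` that does not depend on the gain `k₁`. -/
noncomputable def potentialSlopeBase (x2s : ℝ) (z : ℝ × ℝ × ℝ) : ℝ :=
  2 * z.1 * (x2s / (2 * (2 * x1Star z.2.2 x2s ^ 2 + x2s ^ 2))
      - √2 * z.2.2 * arctanTerm (x1Star z.2.2 x2s) x2s
        / (2 * (2 * x1Star z.2.2 x2s ^ 2 + x2s ^ 2) ^ (3 / 2 : ℝ)))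
    - z.2.2 * (1 + z.2.1) / (2 * z.1 ^ 2 + z.2.1 ^ 2)
    + √2 * z.2.2 * z.1 * arctanTerm z.1 z.2.1 / (2 * z.1 ^ 2 + z.2.1 ^ 2) ^ (3 / 2 : ℝ)

/-- The coefficient of `k₁` in `potentialSlope`. -/
noncomputable def potentialSlopeGain (x2s : ℝ) (z : ℝ × ℝ × ℝ) : ℝ :=
  z.1 * (2 * z.1 ^ 2 + z.2.1 ^ 2 - x2s ^ 2 - 2 * x1Star z.2.2 x2s ^ 2)

/-- The factor `k₁ x₁ (2 (k₂ + x₁²) + x₂²) - D (1 + x₂) / q + √2 D x₁ A / q ^ (3/2)` of the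
feedback, as an affine function of `k₁`. It plays the part of the `x₁`-derivative of the
desired energy function. -/
noncomputable def potentialSlope (x2s k1 : ℝ) (z : ℝ × ℝ × ℝ) : ℝ :=
  k1 * potentialSlopeGain x2s z + potentialSlopeBase x2s z

theorem rpow_three_halves {q : ℝ} (hq : 0 ≤ q) : q ^ (3 / 2 : ℝ) = √q ^ 3 := by
  rw [Real.sqrt_eq_rpow, ← Real.rpow_natCast, ← Real.rpow_mul hq]
  norm_num

theorem potentialSlope_eq {x2s k1 : ℝ} (hk1 : k1 ≠ 0) (x1 x2 d : ℝ) :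
    potentialSlope x2s k1 (x1, x2, d) =
      k1 * x1 * (2 * (k2 d k1 x2s + x1 ^ 2) + x2 ^ 2)
        - d * (1 + x2) / (2 * x1 ^ 2 + x2 ^ 2)
        + √2 * d * x1 * arctanTerm x1 x2 / (2 * x1 ^ 2 + x2 ^ 2) ^ (3 / 2 : ℝ) := by
  have h : ∀ K : ℝ, k1 * (1 / k1 * K) = K := fun K => by field_simp
  simp only [potentialSlope, potentialSlopeGain, potentialSlopeBase, k2]
  linear_combination (-2 * x1) * h (x2s / (2 * (2 * x1Star d x2s ^ 2 + x2s ^ 2))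
      - √2 * d * arctanTerm (x1Star d x2s) x2s
        / (2 * (2 * x1Star d x2s ^ 2 + x2s ^ 2) ^ (3 / 2 : ℝ)))

/-- The factor of the feedback that plays the part of the `x₂`-derivative `b` of the desired energy
is determined by the `x₁`-derivative `a` through the matching condition
`x₂ a - 2 x₁ b = x₁ - d (x₂ + 1) / x₂`. -/
theorem matching_condition {x2s k1 x1 x2 : ℝ} (hk1 : k1 ≠ 0) (hx1 : 0 < x1) (hx2 : 0 < x2)
    (d : ℝ) :
    1 / (2 * x2 * (2 * x1 ^ 2 + x2 ^ 2) ^ (3 / 2 : ℝ)) *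
        (√(2 * x1 ^ 2 + x2 ^ 2) *
            (2 * d * x1 * (1 + x2)
              + x2 * (2 * x1 ^ 2 + x2 ^ 2) *
                (-1 + 2 * k1 * x2 * (k2 d k1 x2s + x1 ^ 2) + k1 * x2 ^ 3))
          + √2 * d * x2 ^ 2 * arctanTerm x1 x2)
      = (x2 * potentialSlope x2s k1 (x1, x2, d) - x1 + d * (x2 + 1) / x2) / (2 * x1) := by
  have hq : 0 < 2 * x1 ^ 2 + x2 ^ 2 := by positivity
  rw [potentialSlope_eq hk1, rpow_three_halves hq.le]
  generalize k2 d k1 x2s = k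
  generalize arctanTerm x1 x2 = A
  have hr : 0 < √(2 * x1 ^ 2 + x2 ^ 2) := Real.sqrt_pos.2 hq
  have hr2 : √(2 * x1 ^ 2 + x2 ^ 2) ^ 2 = 2 * x1 ^ 2 + x2 ^ 2 := Real.sq_sqrt hq.le
  rw [← hr2, Real.sqrt_sq hr.le]
  generalize √(2 * x1 ^ 2 + x2 ^ 2) = r at hr hr2
  field_simp
  linear_combination (-(d * r * (1 + x2))) * hr2

/-- The feedback in terms of `potentialSlope`. -/
theorem uBar_eq {x2s k1 x1 x2 : ℝ} (hk1 : k1 ≠ 0) (hx1 : 0 < x1) (hx2 : 0 < x2) (d : ℝ) :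
    uBar x2s x1 x2 d k1 =
      1 / (x1 ^ 2 + (x2 + 1) ^ 2) *
        (x2 * (x2 + 1) + x1 * (x1 - d / x2)
          - (x2 * (x2 + 1) / x1 + 2 * x1 * x2 / (x2 + 1)) * potentialSlope x2s k1 (x1, x2, d)
          + (2 * x1 ^ 2 / (x2 + 1) ^ 2 - 2 * x2) *
            ((x2 * potentialSlope x2s k1 (x1, x2, d) - x1 + d * (x2 + 1) / x2) / (2 * x1))) := by
  rw [← matching_condition hk1 hx1 hx2, potentialSlope_eq hk1, uBar]
  ring

/-- The first component of the closed-loop field: substituting the matching condition leaves an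
expression that is affine in `potentialSlope`. -/
noncomputable def fieldOne (x2s k1 : ℝ) (z : ℝ × ℝ × ℝ) : ℝ :=
  -(z.2.1 * (2 * z.2.1 + 1)) / (z.1 * (z.2.1 + 1)) * potentialSlope x2s k1 z
    + (z.2.1 / (z.2.1 + 1) - z.2.2 / z.1)

/-- The second component of the closed-loop field, in terms of `potentialSlope`. -/
noncomputable def fieldTwo (D x2s k1 : ℝ) (z : ℝ × ℝ × ℝ) : ℝ :=
  z.2.1 * (2 * z.2.1 + 1) / (z.2.1 + 1) ^ 2 * potentialSlope x2s k1 z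
    + (z.1 / (z.2.1 + 1) ^ 2 - z.2.2 / (z.2.1 * (z.2.1 + 1)) + (z.2.2 - D) / z.2.1)

theorem closedLoopField_eq {D x2s k1 γ : ℝ} (hk1 : k1 ≠ 0) {z : ℝ × ℝ × ℝ} (hz1 : 0 < z.1)
    (hz2 : 0 < z.2.1) :
    closedLoopField D x2s k1 γ z =
      (fieldOne x2s k1 z, fieldTwo D x2s k1 z, -γ * (z.2.2 - D)) := by
  obtain ⟨x1, x2, d⟩ := z
  simp only at hz1 hz2
  simp only [closedLoopField, fieldOne, fieldTwo, uBar_eq hk1 hz1 hz2, Prod.mk.injEq]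
  generalize potentialSlope x2s k1 (x1, x2, d) = a
  have hN : 0 < x1 ^ 2 + (x2 + 1) ^ 2 := by positivity
  refine ⟨?_, ?_, trivial⟩
  · field_simp
    ring
  · field_simp
    ring

/-! ### Linearization at the equilibrium -/

theorem contDiffAt_potentialSlopeBase {x2s : ℝ} (hx2s : 0 < x2s) {z : ℝ × ℝ × ℝ} (hz : 0 < z.2.1) :
    ContDiffAt ℝ 1 (potentialSlopeBase x2s) z := by
  have h1 : 2 * z.1 ^ 2 + z.2.1 ^ 2 ≠ 0 := by positivity
  have h2 : 2 * x1Star z.2.2 x2s ^ 2 + x2s ^ 2 ≠ 0 := by positivity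
  have h3 : z.1 ^ 2 + z.2.1 ^ 2 / 2 ≠ 0 := by positivity
  have h4 : x1Star z.2.2 x2s ^ 2 + x2s ^ 2 / 2 ≠ 0 := by positivity
  have h5 : √(z.1 ^ 2 + z.2.1 ^ 2 / 2) ≠ 0 := by positivity
  have h6 : √(x1Star z.2.2 x2s ^ 2 + x2s ^ 2 / 2) ≠ 0 := by positivity
  have h7 : (2 * z.1 ^ 2 + z.2.1 ^ 2) ^ (3 / 2 : ℝ) ≠ 0 := by positivity
  have h8 : 2 * (2 * x1Star z.2.2 x2s ^ 2 + x2s ^ 2) ^ (3 / 2 : ℝ) ≠ 0 := by positivity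
  have h9 : 2 * (2 * x1Star z.2.2 x2s ^ 2 + x2s ^ 2) ≠ 0 := by positivity
  have harctan : ContDiff ℝ 1 Real.arctan := Real.contDiff_arctan
  unfold potentialSlopeBase arctanTerm x1Star at *
  -- `fun_prop` has no rule for `arctan`, but uses the hypothesis about a variable function.
  generalize Real.arctan = φ at harctan ⊢
  fun_prop (disch := assumption)

theorem x1Star_pos {D x2s : ℝ} (hD : 0 < D) (hx2s : 0 < x2s) : 0 < x1Star D x2s := by
  unfold x1Star; positivity

theorem eq_x1Star_mul_div {D x2s : ℝ} (hx2s : 0 < x2s) :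
    D = x1Star D x2s * x2s / (x2s + 1) := by
  unfold x1Star; field_simp; ring

theorem potentialSlope_equilibrium {D x2s : ℝ} (hx2s : 0 < x2s) (k1 : ℝ) :
    potentialSlope x2s k1 (x1Star D x2s, x2s, D) = 0 := by
  have hq : 2 * x1Star D x2s ^ 2 + x2s ^ 2 ≠ 0 := by positivity
  have hr : (2 * x1Star D x2s ^ 2 + x2s ^ 2) ^ (3 / 2 : ℝ) ≠ 0 := by positivity
  have hD : D * (1 + x2s) = x1Star D x2s * x2s := by
    unfold x1Star; field_simp
  simp only [potentialSlope, potentialSlopeGain, potentialSlopeBase, hD]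
  field_simp
  ring

theorem hasFDerivAt_coord_one (p : ℝ × ℝ × ℝ) :
    HasFDerivAt (fun z : ℝ × ℝ × ℝ => z.1) (functional 1 0 0) p :=
  hasFDerivAt_fst.congr_fderiv (by ext <;> simp)

theorem hasFDerivAt_coord_two (p : ℝ × ℝ × ℝ) :
    HasFDerivAt (fun z : ℝ × ℝ × ℝ => z.2.1) (functional 0 1 0) p :=
  hasFDerivAt_snd.fst.congr_fderiv (by ext <;> simp)

theorem hasFDerivAt_coord_three (p : ℝ × ℝ × ℝ) :
    HasFDerivAt (fun z : ℝ × ℝ × ℝ => z.2.2) (functional 0 0 1) p :=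
  hasFDerivAt_snd.snd.congr_fderiv (by ext <;> simp)

/-- The `x₁`- and `x₂`-derivatives of `potentialSlope` at the equilibrium are affine in the gain.
Only the coefficients of `k₁` enter the argument, so the remaining ones stay unevaluated; they do
not depend on `k₁`. -/
theorem exists_hasFDerivAt_potentialSlope (D : ℝ) {x2s : ℝ} (hx2s : 0 < x2s) :
    ∃ a b : ℝ, ∀ k1 : ℝ, ∃ c : ℝ, HasFDerivAt (potentialSlope x2s k1)
      (functional (k1 * (4 * x1Star D x2s ^ 2) + a) (k1 * (2 * x1Star D x2s * x2s) + b) c)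
      (x1Star D x2s, x2s, D) := by
  set x := x1Star D x2s with hx
  set p : ℝ × ℝ × ℝ := (x, x2s, D) with hp
  have h0 := ((contDiffAt_potentialSlopeBase hx2s (z := p) hx2s).differentiableAt
    one_ne_zero).hasFDerivAt
  set ℓ := fderiv ℝ (potentialSlopeBase x2s) p
  have hX := hasFDerivAt_coord_one p
  have hY := hasFDerivAt_coord_two p
  have hZ : HasFDerivAt (fun z : ℝ × ℝ × ℝ => x1Star z.2.2 x2s)
      (functional 0 0 (1 / x2s + 1)) p := by
    refine (((hasFDerivAt_coord_three p).mul_const (1 / x2s + 1)).congr_fderiv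
      (by ext <;> simp)).congr_of_eventuallyEq (Eventually.of_forall fun z => ?_)
    simp only [x1Star]; ring
  have hg := hX.mul (((((hX.pow 2).const_mul 2).add (hY.pow 2)).sub_const (x2s ^ 2)).sub
    ((hZ.pow 2).const_mul 2))
  refine ⟨ℓ (1, 0, 0), ℓ (0, 1, 0), fun k1 =>
    ⟨k1 * (-4 * x ^ 2 * (1 / x2s + 1)) + ℓ (0, 0, 1), ?_⟩⟩
  refine ((hg.const_mul k1).add h0).congr_fderiv ?_
  have hdec : ∀ z : ℝ × ℝ × ℝ,
      ℓ z = z.1 * ℓ (1, 0, 0) + z.2.1 * ℓ (0, 1, 0) + z.2.2 * ℓ (0, 0, 1) := by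
    intro z
    simp only [← smul_eq_mul, ← map_smul, ← map_add]
    simp
  refine ContinuousLinearMap.ext fun z => ?_
  simp [hdec z, hp, ← hx]
  ring

theorem hasFDerivAt_quotient {E : Type*} [NormedAddCommGroup E] [NormedSpace ℝ E]
    {f g : E → ℝ} {p : E} {f' g' : E →L[ℝ] ℝ} (hf : HasFDerivAt f f' p) (hg : HasFDerivAt g g' p)
    (h0 : g p ≠ 0) :
    HasFDerivAt (fun z => f z / g z) ((1 / g p) • f' - (f p / g p ^ 2) • g') p := by
  have hinv := (hasDerivAt_inv h0).comp_hasFDerivAt p hg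
  refine ((hf.mul hinv).congr_fderiv ?_).congr_of_eventuallyEq
    (Eventually.of_forall fun z => div_eq_mul_inv _ _)
  refine ContinuousLinearMap.ext fun z => ?_
  simp
  field_simp
  ring

/-- The differential of a product at a zero of its second factor. -/
theorem hasFDerivAt_mul_of_eq_zero {E : Type*} [NormedAddCommGroup E] [NormedSpace ℝ E]
    {g f : E → ℝ} {p : E} {f' : E →L[ℝ] ℝ} (hg : DifferentiableAt ℝ g p) (hf : HasFDerivAt f f' p)
    (h0 : f p = 0) : HasFDerivAt (fun z => g z * f z) (g p • f') p :=
  (hg.hasFDerivAt.mul hf).congr_fderiv (by simp [h0])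

theorem hasFDerivAt_fieldOne {D x2s k1 a b c : ℝ} (hD : 0 < D) (hx2s : 0 < x2s)
    (h : HasFDerivAt (potentialSlope x2s k1) (functional a b c) (x1Star D x2s, x2s, D)) :
    ∃ m : ℝ, HasFDerivAt (fieldOne x2s k1)
      (functional
        (-(x2s * (2 * x2s + 1)) / (x1Star D x2s * (x2s + 1)) * a + D / x1Star D x2s ^ 2)
        (-(x2s * (2 * x2s + 1)) / (x1Star D x2s * (x2s + 1)) * b + 1 / (x2s + 1) ^ 2) m)
      (x1Star D x2s, x2s, D) := by
  have hx := x1Star_pos hD hx2s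
  have h0 := potentialSlope_equilibrium (D := D) hx2s k1
  set x := x1Star D x2s
  set p : ℝ × ℝ × ℝ := (x, x2s, D) with hp
  have hX := hasFDerivAt_coord_one p
  have hY := hasFDerivAt_coord_two p
  have hZ := hasFDerivAt_coord_three p
  have hx2 : x2s + 1 ≠ 0 := by positivity
  have hg : DifferentiableAt ℝ (fun z : ℝ × ℝ × ℝ =>
      -(z.2.1 * (2 * z.2.1 + 1)) / (z.1 * (z.2.1 + 1))) p := by
    have : p.1 * (p.2.1 + 1) ≠ 0 := mul_ne_zero hx.ne' hx2
    fun_prop (disch := assumption)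
  refine ⟨-(x2s * (2 * x2s + 1)) / (x * (x2s + 1)) * c - 1 / x,
    ((hasFDerivAt_mul_of_eq_zero hg h h0).add
    ((hasFDerivAt_quotient hY (hY.add_const 1) hx2).sub
      (hasFDerivAt_quotient hZ hX hx.ne'))).congr_fderiv ?_⟩
  refine ContinuousLinearMap.ext fun z => ?_
  simp [hp]
  field_simp
  ring

theorem hasFDerivAt_fieldTwo {D x2s k1 a b c : ℝ} (hx2s : 0 < x2s)
    (h : HasFDerivAt (potentialSlope x2s k1) (functional a b c) (x1Star D x2s, x2s, D)) :
    ∃ m : ℝ, HasFDerivAt (fieldTwo D x2s k1)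
      (functional
        (x2s * (2 * x2s + 1) / (x2s + 1) ^ 2 * a + 1 / (x2s + 1) ^ 2)
        (x2s * (2 * x2s + 1) / (x2s + 1) ^ 2 * b
          + (-2 * x1Star D x2s / (x2s + 1) ^ 3
            + D * (2 * x2s + 1) / (x2s ^ 2 * (x2s + 1) ^ 2))) m)
      (x1Star D x2s, x2s, D) := by
  have h0 := potentialSlope_equilibrium (D := D) hx2s k1
  set x := x1Star D x2s
  set p : ℝ × ℝ × ℝ := (x, x2s, D) with hp
  have hX := hasFDerivAt_coord_one p
  have hY := hasFDerivAt_coord_two p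
  have hZ := hasFDerivAt_coord_three p
  have hx2 : x2s + 1 ≠ 0 := by positivity
  have hg : DifferentiableAt ℝ (fun z : ℝ × ℝ × ℝ =>
      z.2.1 * (2 * z.2.1 + 1) / (z.2.1 + 1) ^ 2) p := by
    have : (p.2.1 + 1) ^ 2 ≠ 0 := pow_ne_zero 2 hx2
    fun_prop (disch := assumption)
  refine ⟨x2s * (2 * x2s + 1) / (x2s + 1) ^ 2 * c - 1 / (x2s * (x2s + 1)) + 1 / x2s,
    ((hasFDerivAt_mul_of_eq_zero hg h h0).add
    (((hasFDerivAt_quotient hX ((hY.add_const 1).pow 2) (pow_ne_zero 2 hx2)).sub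
      (hasFDerivAt_quotient hZ (hY.mul (hY.add_const 1)) (mul_ne_zero hx2s.ne' hx2))).add
        (hasFDerivAt_quotient (hZ.sub_const D) hY hx2s.ne'))).congr_fderiv ?_⟩
  refine ContinuousLinearMap.ext fun z => ?_
  simp [hp]
  field_simp
  ring

theorem contDiffAt_closedLoopField {D x2s k1 : ℝ} (hD : 0 < D) (hx2s : 0 < x2s) (γ : ℝ) :
    ContDiffAt ℝ 1 (fun z : ℝ × ℝ × ℝ => (fieldOne x2s k1 z, fieldTwo D x2s k1 z, -γ * (z.2.2 - D)))
      (x1Star D x2s, x2s, D) := by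
  have hx := x1Star_pos hD hx2s
  set p : ℝ × ℝ × ℝ := (x1Star D x2s, x2s, D) with hp
  have hb := contDiffAt_potentialSlopeBase hx2s (z := p) hx2s
  have h1 : p.1 ≠ 0 := hx.ne'
  have h2 : p.2.1 ≠ 0 := hx2s.ne'
  have h3 : p.2.1 + 1 ≠ 0 := by simp only [hp]; positivity
  have h4 : p.1 * (p.2.1 + 1) ≠ 0 := mul_ne_zero h1 h3
  have h5 : p.2.1 * (p.2.1 + 1) ≠ 0 := mul_ne_zero h2 h3
  have h6 : (p.2.1 + 1) ^ 2 ≠ 0 := pow_ne_zero 2 h3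
  have hs : ContDiffAt ℝ 1 (potentialSlope x2s k1) p := by
    unfold potentialSlope potentialSlopeGain x1Star
    fun_prop (disch := assumption)
  unfold fieldOne fieldTwo
  fun_prop (disch := assumption)

/-- For large gains the planar part of the linearization has negative trace and positive
determinant: both are affine in `k₁`, the rank-one term that `k₁` multiplies making the determinant
so. The condition `2 x₁⋆² < x₂⋆² (1 + x₂⋆)` says that the coefficient of `k₁` in the determinant is
positive. -/
theorem exists_gain_trace_neg_det_pos {D x2s : ℝ} (hD : 0 < D) (hx2s : 0 < x2s)
    (hstar : 2 * x1Star D x2s ^ 2 < x2s ^ 2 * (1 + x2s)) (a b : ℝ) :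
    ∃ k1min : ℝ, 0 ≤ k1min ∧ ∀ k1 > k1min,
      ∀ m11 m12 m21 m22 : ℝ,
      m11 = -(x2s * (2 * x2s + 1)) / (x1Star D x2s * (x2s + 1))
        * (k1 * (4 * x1Star D x2s ^ 2) + a) + D / x1Star D x2s ^ 2 →
      m12 = -(x2s * (2 * x2s + 1)) / (x1Star D x2s * (x2s + 1))
        * (k1 * (2 * x1Star D x2s * x2s) + b) + 1 / (x2s + 1) ^ 2 →
      m21 = x2s * (2 * x2s + 1) / (x2s + 1) ^ 2 * (k1 * (4 * x1Star D x2s ^ 2) + a)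
        + 1 / (x2s + 1) ^ 2 →
      m22 = x2s * (2 * x2s + 1) / (x2s + 1) ^ 2 * (k1 * (2 * x1Star D x2s * x2s) + b)
        + (-2 * x1Star D x2s / (x2s + 1) ^ 3 + D * (2 * x2s + 1) / (x2s ^ 2 * (x2s + 1) ^ 2)) →
      m11 + m22 < 0 ∧ 0 < m11 * m22 - m12 * m21 := by
  have hx := x1Star_pos hD hx2s
  have hDx := eq_x1Star_mul_div (D := D) hx2s
  set x := x1Star D x2s
  set y := x2s
  set g := y * (2 * y + 1) / (y + 1) ^ 2 with hg
  have hg0 : 0 < g := by positivity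
  have hg1 : -(y * (2 * y + 1)) / (x * (y + 1)) = -(g * (y + 1) / x) := by
    rw [hg]; field_simp
  -- trace `= -t1 k₁ + t0` and determinant `= d1 k₁ + d0`
  set t1 := g * x * (2 * y + 4) with ht1
  set t0 := -(g * (y + 1) / x) * a + D / x ^ 2
    + g * b + (-2 * x / (y + 1) ^ 3 + D * (2 * y + 1) / (y ^ 2 * (y + 1) ^ 2)) with ht0
  set d1 := 2 * g / (y * (y + 1)) * (y ^ 2 * (1 + y) - 2 * x ^ 2) with hd1
  set d0 := g * (-(a / (y * (y + 1) ^ 2)) + y * b / (x * (y + 1)) + b / (x * (y + 1))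
    - a / (y + 1) ^ 2) with hd0
  have ht1p : 0 < t1 := by positivity
  have hd1p : 0 < d1 := mul_pos (by positivity) (sub_pos.2 hstar)
  refine ⟨max 0 (max (t0 / t1) (-d0 / d1)), le_max_left _ _, ?_⟩
  intro k1 hk m11 m12 m21 m22 h11 h12 h21 h22
  have hk1 : t0 / t1 < k1 := lt_of_le_of_lt ((le_max_left _ _).trans (le_max_right _ _)) hk
  have hk2 : -d0 / d1 < k1 := lt_of_le_of_lt ((le_max_right _ _).trans (le_max_right _ _)) hk
  rw [div_lt_iff₀ ht1p] at hk1
  rw [div_lt_iff₀ hd1p] at hk2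
  rw [hg1] at h11 h12
  constructor
  · have h : m11 + m22 = -(k1 * t1) + t0 := by
      rw [h11, h22, ht1, ht0]; field_simp; ring
    linarith
  · have h : m11 * m22 - m12 * m21 = k1 * d1 + d0 := by
      rw [h11, h12, h21, h22, hd1, hd0]
      clear_value g
      rw [hDx]
      field_simp
      ring
    linarith

/-! ### Stability of the closed loop -/

/-- The estimation error is a solution of `e' = -γ e`. -/
theorem estimation_error_eq {D x2s k1 γ T : ℝ} {s : ℝ → ℝ × ℝ × ℝ}
    (hs : IsClosedLoopTrajectory D x2s k1 γ (Ico 0 T) s) :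
    ∀ t ∈ Ico 0 T, (s t).2.2 - D = Real.exp (-γ * t) * ((s 0).2.2 - D) := by
  intro t ht
  rw [isClosedLoopTrajectory_iff] at hs
  have hd : ∀ τ ∈ Ico 0 T, HasDerivWithinAt (fun t => Real.exp (γ * t) * ((s t).2.2 - D)) 0
      (Ico 0 T) τ := by
    intro τ hτ
    have h23 := hasFDerivAt_snd.comp_hasDerivWithinAt τ (hs τ hτ).2
    have h3 : HasDerivWithinAt (fun t => (s t).2.2) (-γ * ((s τ).2.2 - D)) (Ico 0 T) τ :=
      (hasFDerivAt_snd (𝕜 := ℝ) (E := ℝ) (F := ℝ)).comp_hasDerivWithinAt τ h23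
    have he : HasDerivWithinAt (fun t => Real.exp (γ * t)) (Real.exp (γ * τ) * γ) (Ico 0 T) τ := by
      have h1 : HasDerivAt (fun t => γ * t) γ τ := by
        simpa using (hasDerivAt_id τ).const_mul γ
      exact h1.exp.hasDerivWithinAt
    exact (he.mul (h3.sub_const D)).congr_deriv (by ring)
  have hsub : Icc 0 t ⊆ Ico 0 T := fun τ hτ => ⟨hτ.1, hτ.2.trans_lt ht.2⟩
  have hconst := constant_of_has_deriv_right_zero (a := 0) (b := t)
    (fun τ hτ => (hd τ (hsub hτ)).continuousWithinAt.mono hsub)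
    (fun τ hτ => (hd τ (hsub ⟨hτ.1, hτ.2.le⟩)).mono_of_mem_nhdsWithin
      (mem_of_superset (Ico_mem_nhdsGE (hτ.2.trans ht.2)) (Ico_subset_Ico_left hτ.1)))
    t ⟨ht.1, le_rfl⟩
  simp only [mul_zero, Real.exp_zero, one_mul] at hconst
  rw [← hconst, ← mul_assoc, ← Real.exp_add]
  simp

theorem exists_gain_isAsymptoticallyStable {D x2s : ℝ} (hD : 0 < D) (hx2s : 0 < x2s)
    (hstar : 2 * x1Star D x2s ^ 2 < x2s ^ 2 * (1 + x2s)) :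
    ∃ k1min : ℝ, ∀ k1 > k1min, ∀ γ > 0,
      IsAsymptoticallyStable (IsClosedLoopTrajectory D x2s k1 γ) (x1Star D x2s, x2s, D) := by
  obtain ⟨a, b, hab⟩ := exists_hasFDerivAt_potentialSlope D hx2s
  obtain ⟨k1min, hk0, hk⟩ := exists_gain_trace_neg_det_pos hD hx2s hstar a b
  refine ⟨k1min, fun k1 hk1 γ hγ => ?_⟩
  obtain ⟨htr, hdet⟩ := hk k1 hk1 _ _ _ _ rfl rfl rfl rfl
  obtain ⟨c, hc⟩ := hab k1
  obtain ⟨m1, hm1⟩ := hasFDerivAt_fieldOne hD hx2s hc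
  obtain ⟨m2, hm2⟩ := hasFDerivAt_fieldTwo hx2s hc
  have hx := x1Star_pos hD hx2s
  have h0 := potentialSlope_equilibrium (D := D) hx2s k1
  have hm3 : HasFDerivAt (fun z : ℝ × ℝ × ℝ => -γ * (z.2.2 - D)) (functional 0 0 (-γ))
      (x1Star D x2s, x2s, D) :=
    (((hasFDerivAt_coord_three _).sub_const D).const_mul (-γ)).congr_fderiv (by ext <;> simp)
  set p : ℝ × ℝ × ℝ := (x1Star D x2s, x2s, D) with hp
  have hU : {z : ℝ × ℝ × ℝ | 0 < z.1 ∧ 0 < z.2.1} ∈ 𝓝 p :=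
    ((isOpen_lt continuous_const continuous_fst).inter
      (isOpen_lt continuous_const (continuous_fst.comp continuous_snd))).mem_nhds ⟨hx, hx2s⟩
  have hne : k1 ≠ 0 := (hk0.trans_lt hk1).ne'
  have hev : closedLoopField D x2s k1 γ =ᶠ[𝓝 p]
      fun z => (fieldOne x2s k1 z, fieldTwo D x2s k1 z, -γ * (z.2.2 - D)) := by
    filter_upwards [hU] with z hz
    exact closedLoopField_eq hne hz.1 hz.2
  have hzero : closedLoopField D x2s k1 γ p = 0 := by
    rw [closedLoopField_eq hne hx hx2s]
    simp only [fieldOne, fieldTwo, h0, mul_zero, zero_add]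
    simp only [hp, sub_self, zero_div, add_zero, mul_zero]
    refine Prod.mk_eq_zero.2 ⟨?_, Prod.mk_eq_zero.2 ⟨?_, rfl⟩⟩
    · rw [sub_eq_zero, div_eq_div_iff (by positivity) hx.ne']
      unfold x1Star
      field_simp
      ring
    · rw [sub_eq_zero, div_eq_div_iff (by positivity) (by positivity)]
      unfold x1Star
      field_simp
      ring
  obtain ⟨B, c', hc', m, hm, hsymm, hpos, hneg⟩ :=
    exists_quadratic_lyapunov_cascade (a13 := m1) (a23 := m2) hγ htr hdet
  have key := isAsymptoticallyStable_of_quadratic hU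
    ((contDiffAt_closedLoopField hD hx2s γ).congr_of_eventuallyEq hev) hzero
    ((hm1.prodMk (hm2.prodMk hm3)).congr_of_eventuallyEq hev) hsymm hc' hm hpos hneg
  have htraj : IsClosedLoopTrajectory D x2s k1 γ = fun I s => ∀ t ∈ I,
      s t ∈ {z : ℝ × ℝ × ℝ | 0 < z.1 ∧ 0 < z.2.1} ∧
        HasDerivWithinAt s (closedLoopField D x2s k1 γ (s t)) I t :=
    funext fun I => funext fun s => propext isClosedLoopTrajectory_iff
  rw [htraj]
  exact key

end BuckBoost

theorem proposition4 (D x2s : ℝ) (hD : 0 < D) (hx2s : 0 < x2s) :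
    (∀ k1 γ : ℝ, 0 < γ → ∀ T > 0, ∀ s : ℝ → ℝ × ℝ × ℝ,
      BuckBoost.IsClosedLoopTrajectory D x2s k1 γ (Set.Ico 0 T) s →
        ∀ t ∈ Set.Ico 0 T, (s t).2.2 - D = Real.exp (-γ * t) * ((s 0).2.2 - D)) ∧
    (2 * BuckBoost.x1Star D x2s ^ 2 < x2s ^ 2 * (1 + x2s) →
      ∃ k1min : ℝ, ∀ k1 > k1min, ∀ γ > 0,
        BuckBoost.IsAsymptoticallyStable
          (BuckBoost.IsClosedLoopTrajectory D x2s k1 γ)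
          (BuckBoost.x1Star D x2s, x2s, D)) :=
  ⟨fun _ _ _ _ _ _ hs => BuckBoost.estimation_error_eq hs,
    fun hstar => BuckBoost.exists_gain_isAsymptoticallyStable hD hx2s hstar⟩
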